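/- Let $h_n$, $e_n$ denote the complete homogeneous and elementary symmetric functions of degree $n$ and, for a partition $\lambda$, let $p_\lambda=\prod_i p_{\lambda_i}$ be the power sum symmetric function. For a partition $\mu$ of $n$ let $\psi_\mu=\sum_{\lambda} p_\lambda$, where $\lambda$ ranges over the interval $[(1^n),\mu]$ of the reverse lexicographic order on the partitions of $n$ (in which $\lambda<\nu$ if and only if $\lambda_j<\nu_j$ at the first index $j$ where $\lambda$ and $\nu$ differ, so that $(1^n)$ is the least and $(n)$ the greatest element). For $m\ge 0$ let $\psi_{2^m}$ be $\psi_\mu$ for the partition $\mu=(2^m)$ of $2m$, so that $\psi_{2^0}=1$. A symmetric function is called Schur-positive if it is a linear combination of Schur functions with nonnegative integer coefficients (the zero function is included). Put $\mathrm{Odd}(n)=1$ if $n$ is odd and $\mathrm{Odd}(n)=0$ otherwise. (1) For every $m\ge 1$, the symmetric function $\psi_{2^m}-h_2\,\psi_{2^{m-1}}$ is Schur-positive, and $$\psi_{2^m}-h_2\,\psi_{2^{m-1}}=\sum_{\substack{1\le j\le m\\ j\text{ odd}}}\binom{m}{j-1}\,h_2^{\,m+1-j}\,e_2^{\,j-1}+e_2^{\,m}\,\mathrm{Odd}(m+1).$$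 (2) More generally, for all integers $0\le k\le m$, the symmetric function $\psi_{2^m}-h_2^{\,k}\,\psi_{2^{m-k}}$ is Schur-positive. -/

import Mathlib

open MvPolynomial

/-- Ambient ring for symmetric functions over `ℤ`. A symmetric function `f` in the variables
`x₀, x₁, x₂, …` is recorded by the family of its specialisations `f(x₀, …, x_{N-1})`, `N : ℕ`;
the ring of symmetric functions (the graded inverse limit of the rings of symmetric polynomials)
is in this way a subring of the product ring `∏ N, ℤ[x₀, …, x_{N-1}]`, with componentwise
operations. -/
abbrev SymFamily : Type := (N : ℕ) → MvPolynomial (Fin N) ℤ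

namespace SymFamily

/-- The complete homogeneous symmetric function `h_n`. -/
noncomputable def h (n : ℕ) : SymFamily := fun N => hsymm (Fin N) ℤ n

/-- The elementary symmetric function `e_n`. -/
noncomputable def e (n : ℕ) : SymFamily := fun N => esymm (Fin N) ℤ n

/-- The power sum symmetric function `p_lam = ∏ i, p_{lam_i}` of a partition `lam`. -/
noncomputable def p {n : ℕ} (lam : n.Partition) : SymFamily := fun N => psumPart (Fin N) ℤ lam

/-- Semistandard Young tableaux of shape `μ` with all entries in `{0, …, N-1}`. -/
abbrev BoundedTableau (N : ℕ) (μ : YoungDiagram) : Type :=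
  {T : SemistandardYoungTableau μ // ∀ c ∈ μ.cells, T c.1 c.2 < N}

instance finite_boundedTableau (N : ℕ) (μ : YoungDiagram) : Finite (BoundedTableau N μ) := by
  refine Finite.of_injective
    (fun (T : BoundedTableau N μ) (c : μ.cells) => (⟨T.1 c.1.1 c.1.2, T.2 c.1 c.2⟩ : Fin N)) ?_
  intro T T' hTT
  apply Subtype.ext
  apply SemistandardYoungTableau.ext
  intro i j
  by_cases hc : (i, j) ∈ μ
  · have := congrFun hTT ⟨(i, j), (YoungDiagram.mem_cells _).2 hc⟩
    simpa using this
  · rw [T.1.zeros hc, T'.1.zeros hc]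

noncomputable instance fintype_boundedTableau (N : ℕ) (μ : YoungDiagram) :
    Fintype (BoundedTableau N μ) := Fintype.ofFinite _

/-- The Schur function `s_μ`: the sum over semistandard Young tableaux `T` of shape `μ` of the
monomial `∏ c ∈ μ, x_{T(c)}`. -/
noncomputable def schur (μ : YoungDiagram) : SymFamily := fun N =>
  ∑ T : BoundedTableau N μ, ∏ c : μ.cells, X (⟨T.1 c.1.1 c.1.2, T.2 c.1 c.2⟩ : Fin N)

/-- `f` is Schur-positive: it is a (finite) linear combination of Schur functions with
nonnegative integer coefficients. The coefficients do not depend on the number of variables. -/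
def IsSchurPositive (f : SymFamily) : Prop :=
  ∃ c : YoungDiagram →₀ ℕ, f = c.sum fun μ a => a • schur μ

end SymFamily

namespace RevLex

/-- The `i`-th part (starting from `i = 0`) of a partition, the parts being listed in weakly
decreasing order and followed by zeros. -/
def part {n : ℕ} (lam : n.Partition) (i : ℕ) : ℕ :=
  (lam.parts.sort (· ≥ ·)).getD i 0

/-- `lam < mu` in reverse lexicographic order on partitions of `n`: at the first place where they
differ, `mu` has the larger part. So `(1^n)` is the least and `(n)` the greatest element. -/
def Lt {n : ℕ} (lam mu : n.Partition) : Prop :=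
  ∃ j, (∀ i < j, part lam i = part mu i) ∧ part lam j < part mu j

/-- `lam ≤ mu` in reverse lexicographic order. -/
def Le {n : ℕ} (lam mu : n.Partition) : Prop := lam = mu ∨ Lt lam mu

end RevLex

/-- The partition `(1^n)` of `n`. -/
def onesPartition (n : ℕ) : n.Partition where
  parts := Multiset.replicate n 1
  parts_pos := fun hi => by rw [Multiset.eq_of_mem_replicate hi]; exact one_pos
  parts_sum := by simp

/-- The partition `(2^m)` of `2 * m`. -/
def twosPartition (m : ℕ) : (2 * m).Partition where
  parts := Multiset.replicate m 2
  parts_pos := fun hi => by rw [Multiset.eq_of_mem_replicate hi]; exact two_pos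
  parts_sum := by simp [mul_comm]

open Classical in
/-- `ψ_μ`: the sum of the power sums `p_lam` over all `lam` in the interval `[(1^n), μ]` of the
reverse lexicographic order on partitions of `n`. -/
noncomputable def psi {n : ℕ} (mu : n.Partition) : SymFamily :=
  ∑ lam : n.Partition with RevLex.Le (onesPartition n) lam ∧ RevLex.Le lam mu, SymFamily.p lam

/-! A partition of `2 * m` lies below `(2^m)` exactly when its parts are at most 2, so `ψ` is the
sum of `p_2^i * p_1^(2(m-i))` over `0 ≤ i ≤ m`. Since `p_1² = h_2 + e_2` and `p_2 = h_2 - e_2`, this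
geometric sum is `((h_2 + e_2)^(m+1) - (h_2 - e_2)^(m+1)) / (2 e_2)`, that is, the sum of `C(m+1, j)
h_2^(m+1-j) e_2^(j-1)` over odd `j` (`sum_sub_pow_mul_add_pow`). Subtracting `h_2^k ψ_{2^(m-k)}`
replaces `C(m+1, j)` by `C(m+1, j) - C(m+1-k, j) ≥ 0`; for `k = 1`, Pascal's rule gives the stated
formula.

It remains to see that `h_2^a e_2^b` is Schur-positive. Multiplication by `h_2` is covered by
Pieri's rule (`hEval_mul_schurEval`), proved by induction on the number of variables from the
branching rule and a growth-diagram bijection. For `e_2 = h_1² - h_2`, every diagram in `h_2 s_μ`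
already occurs in `h_1 (h_1 s_μ)`, so the difference is positive (`e_two_mul_schur`). -/

namespace YoungDiagram

/-! ### Young diagrams through row lengths, horizontal strips and local rules -/

theorem eq_of_rowLen_eq {μ ν : YoungDiagram} (h : ∀ i, μ.rowLen i = ν.rowLen i) : μ = ν := by
  ext ⟨i, j⟩
  simp only [mem_cells, mem_iff_lt_rowLen, h]

theorem exists_rowLen_eq_zero (μ : YoungDiagram) : ∃ n, ∀ i, n ≤ i → μ.rowLen i = 0 := by
  refine ⟨μ.colLen 0, fun i hi => ?_⟩
  by_contra h
  have : (i, 0) ∈ μ := mem_iff_lt_rowLen.2 (Nat.pos_of_ne_zero h)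
  rw [mem_iff_lt_colLen] at this
  omega

theorem card_eq_sum_rowLen (μ : YoungDiagram) {n : ℕ} (hn : ∀ i, n ≤ i → μ.rowLen i = 0) :
    μ.card = ∑ i ∈ Finset.range n, μ.rowLen i := by
  have h : μ.cells = ((Finset.range n).sigma fun i => Finset.range (μ.rowLen i)).map
      (Equiv.sigmaEquivProd ℕ ℕ).toEmbedding := by
    ext ⟨i, j⟩
    simp only [mem_cells, Finset.mem_map_equiv, Finset.mem_sigma, Finset.mem_range,
      Equiv.sigmaEquivProd_symm_apply, mem_iff_lt_rowLen]
    refine ⟨fun h => ⟨?_, h⟩, fun h => h.2⟩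
    by_contra hi
    have := hn i (by omega)
    omega
  rw [YoungDiagram.card, h, Finset.card_map, Finset.card_sigma]
  simp

theorem exists_rowLen_eq {f : ℕ → ℕ} (hf : Antitone f) {n : ℕ} (hn : f n = 0) :
    ∃ μ : YoungDiagram, ∀ i, μ.rowLen i = f i := by
  let μ : YoungDiagram :=
    -- The box only makes the set of cells finite: by antitonicity the condition `c.2 < f c.1`
    -- already confines the cells to it.
    { cells := (Finset.range n ×ˢ Finset.range (f 0)).filter fun c => c.2 < f c.1
      isLowerSet := by
        rintro ⟨i, j⟩ ⟨i', j'⟩ ⟨hi, hj⟩ h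
        simp only [Finset.coe_filter, Finset.mem_product, Finset.mem_range,
          Set.mem_ofPred_eq] at h hi hj ⊢
        have := hf hi
        omega }
  refine ⟨μ, fun i => ?_⟩
  have key : ∀ j, j < μ.rowLen i ↔ j < f i := by
    intro j
    rw [← mem_iff_lt_rowLen]
    change (i, j) ∈ (Finset.range n ×ˢ Finset.range (f 0)).filter (fun c => c.2 < f c.1) ↔ _
    simp only [Finset.mem_filter, Finset.mem_product, Finset.mem_range]
    refine ⟨fun h => h.2, fun h => ⟨⟨?_, ?_⟩, h⟩⟩
    · by_contra hi
      have := hf (not_lt.1 hi)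
      omega
    · exact h.trans_le (hf (Nat.zero_le i))
  have h1 := key (μ.rowLen i)
  have h2 := key (f i)
  omega

/-- `IsHorizontalStrip ν μ` says that `ν` is contained in `μ` and that `μ / ν` has at most one
cell in each column, i.e. that the row lengths interlace. -/
def IsHorizontalStrip (ν μ : YoungDiagram) : Prop :=
  ∀ i, ν.rowLen i ≤ μ.rowLen i ∧ μ.rowLen (i + 1) ≤ ν.rowLen i

theorem le_of_rowLen_le {ν μ : YoungDiagram} (h : ∀ i, ν.rowLen i ≤ μ.rowLen i) : ν ≤ μ := by
  rw [← cells_subset_iff]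
  rintro ⟨i, j⟩
  simp only [mem_cells, mem_iff_lt_rowLen]
  exact fun hj => hj.trans_le (h i)

theorem IsHorizontalStrip.le {ν μ : YoungDiagram} (h : IsHorizontalStrip ν μ) : ν ≤ μ :=
  le_of_rowLen_le fun i => (h i).1

theorem card_le_card {ν μ : YoungDiagram} (h : ν ≤ μ) : ν.card ≤ μ.card :=
  Finset.card_le_card (cells_subset_iff.2 h)

theorem finite_of_cells_subset (s : Finset (ℕ × ℕ)) : {μ : YoungDiagram | μ.cells ⊆ s}.Finite := by
  refine Set.Finite.of_injOn (f := YoungDiagram.cells) (t := (s.powerset : Set (Finset (ℕ × ℕ))))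
    (fun μ hμ => by simpa using hμ) (fun μ _ ν _ h => YoungDiagram.ext h) (Finset.finite_toSet _)

theorem finite_card_eq (n : ℕ) : {μ : YoungDiagram | μ.card = n}.Finite := by
  refine (finite_of_cells_subset (Finset.range n ×ˢ Finset.range n)).subset ?_
  rintro μ rfl ⟨i, j⟩ h
  rw [mem_cells] at h
  have h1 : μ.rowLen i ≤ μ.card := by
    rw [rowLen_eq_card]
    exact Finset.card_le_card (Finset.filter_subset _ _)
  have h2 : μ.colLen j ≤ μ.card := by
    rw [colLen_eq_card]
    exact Finset.card_le_card (Finset.filter_subset _ _)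
  have h3 := mem_iff_lt_rowLen.1 h
  have h4 := mem_iff_lt_colLen.1 h
  simp only [Finset.mem_product, Finset.mem_range]
  omega

/-- The diagrams obtained from `μ` by adding a horizontal strip with `r` cells. -/
noncomputable def addStrip (μ : YoungDiagram) (r : ℕ) : Finset YoungDiagram :=
  ((finite_card_eq (μ.card + r)).subset
    (t := {ν | IsHorizontalStrip μ ν ∧ ν.card = μ.card + r}) fun _ h => h.2).toFinset

/-- The diagrams obtained from `μ` by removing a horizontal strip. -/
noncomputable def removeStrip (μ : YoungDiagram) : Finset YoungDiagram :=
  ((finite_of_cells_subset μ.cells).subset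
    (t := {ν | IsHorizontalStrip ν μ}) fun _ h => cells_subset_iff.2 h.le).toFinset

@[simp]
theorem mem_addStrip {μ ν : YoungDiagram} {r : ℕ} :
    ν ∈ addStrip μ r ↔ IsHorizontalStrip μ ν ∧ ν.card = μ.card + r := by
  simp [addStrip]

@[simp]
theorem mem_removeStrip {μ ν : YoungDiagram} : ν ∈ removeStrip μ ↔ IsHorizontalStrip ν μ := by
  simp [removeStrip]

theorem isHorizontalStrip_refl (μ : YoungDiagram) : IsHorizontalStrip μ μ :=
  fun i => ⟨le_rfl, μ.rowLen_anti i (i + 1) (Nat.le_succ i)⟩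

theorem addStrip_zero (μ : YoungDiagram) : addStrip μ 0 = {μ} := by
  ext ν
  simp only [mem_addStrip, add_zero, Finset.mem_singleton]
  constructor
  · rintro ⟨h, hc⟩
    exact (YoungDiagram.ext (Finset.eq_of_subset_of_card_le (cells_subset_iff.2 h.le) hc.le)).symm
  · rintro rfl
    exact ⟨isHorizontalStrip_refl ν, rfl⟩

/-- The local rule of growth diagrams for horizontal strips: in every row, `lam` and `κ` are
reflections of each other inside the interval of row lengths compatible with `μ` and `ν`. -/
def LocalRule (μ ν κ lam : YoungDiagram) (k : ℕ) : Prop :=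
  lam.rowLen 0 = max (μ.rowLen 0) (ν.rowLen 0) + k ∧
  ∀ i, lam.rowLen (i + 1) + κ.rowLen i =
    max (μ.rowLen (i + 1)) (ν.rowLen (i + 1)) + min (μ.rowLen i) (ν.rowLen i)

/-- Summing the rule over all rows and using `max + min = μ_i + ν_i` leaves only the `k` extra cells
of row 0. This is what makes the bijection in Pieri's rule preserve degrees. -/
theorem LocalRule.card_add_card {μ ν κ lam : YoungDiagram} {k : ℕ} (h : LocalRule μ ν κ lam k) :
    lam.card + κ.card = μ.card + ν.card + k := by
  obtain ⟨a, ha⟩ := μ.exists_rowLen_eq_zero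
  obtain ⟨b, hb⟩ := ν.exists_rowLen_eq_zero
  obtain ⟨c, hc⟩ := κ.exists_rowLen_eq_zero
  obtain ⟨d, hd⟩ := lam.exists_rowLen_eq_zero
  set n := a + b + c + d
  rw [μ.card_eq_sum_rowLen (n := n + 1) fun i hi => ha i (by omega),
    ν.card_eq_sum_rowLen (n := n + 1) fun i hi => hb i (by omega),
    κ.card_eq_sum_rowLen (n := n) fun i hi => hc i (by omega),
    lam.card_eq_sum_rowLen (n := n + 1) fun i hi => hd i (by omega),
    ← Finset.sum_add_distrib]
  simp_rw [← max_add_min (μ.rowLen _) (ν.rowLen _)]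
  rw [Finset.sum_add_distrib, Finset.sum_range_succ', Finset.sum_range_succ' (fun i => max _ _),
    Finset.sum_range_succ (fun i => min _ _), ha n (by omega), h.1]
  have := Finset.sum_congr (rfl : Finset.range n = _) fun i _ => h.2 i
  simp only [Finset.sum_add_distrib] at this
  simp only [zero_le, inf_of_le_left]
  omega

/-- For each `i`, both `κ_i` and `lam_(i+1)` are required to lie in the interval from `max μ_(i+1)
ν_(i+1)` to `min μ_i ν_i`, and the rule reflects this interval onto itself. Row 0 of `lam` is
bounded only from below, which leaves `k` free. -/
theorem LocalRule.isHorizontalStrip_upper {μ ν κ lam : YoungDiagram} {k : ℕ}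
    (h : LocalRule μ ν κ lam k) (hμ : IsHorizontalStrip κ μ) (hν : IsHorizontalStrip κ ν) :
    IsHorizontalStrip μ lam ∧ IsHorizontalStrip ν lam := by
  constructor <;> rintro (_ | i)
  all_goals
    constructor
    all_goals first
      | (have h1 := h.1; have h2 := h.2 0; have h3 := hμ 0; have h4 := hν 0
         simp only [zero_add] at *; omega)
      | (have h0 := h.2 i; have h2 := h.2 (i + 1); have h3 := hμ i; have h4 := hν i
         have h5 := hμ (i + 1); have h6 := hν (i + 1); omega)

theorem LocalRule.isHorizontalStrip_lower {μ ν κ lam : YoungDiagram} {k : ℕ}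
    (h : LocalRule μ ν κ lam k) (hμ : IsHorizontalStrip μ lam) (hν : IsHorizontalStrip ν lam) :
    IsHorizontalStrip κ μ ∧ IsHorizontalStrip κ ν := by
  constructor <;> intro i <;> have h2 := h.2 i <;> have h3 := hμ i <;> have h4 := hν i <;>
    have h5 := hμ (i + 1) <;> have h6 := hν (i + 1) <;> omega

theorem exists_localRule_upper {μ ν κ : YoungDiagram} (k : ℕ) (hμ : IsHorizontalStrip κ μ)
    (hν : IsHorizontalStrip κ ν) : ∃ lam, LocalRule μ ν κ lam k := by
  obtain ⟨a, ha⟩ := μ.exists_rowLen_eq_zero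
  -- The truncated subtraction is exact because `κ_i ≤ min μ_i ν_i`.
  let f : ℕ → ℕ
    | 0 => max (μ.rowLen 0) (ν.rowLen 0) + k
    | i + 1 => max (μ.rowLen (i + 1)) (ν.rowLen (i + 1)) + min (μ.rowLen i) (ν.rowLen i) -
        κ.rowLen i
  have hf : Antitone f := by
    refine antitone_nat_of_succ_le ?_
    rintro (_ | i)
    · have h3 := hμ 0; have h4 := hν 0
      simp only [f, zero_add] at *
      omega
    · have h3 := hμ i; have h4 := hν i; have h5 := hμ (i + 1); have h6 := hν (i + 1)
      simp only [f]
      omega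
  obtain ⟨lam, hl⟩ := exists_rowLen_eq hf (n := a + 1) (by
    have h3 := hμ a; have h4 := hν a; have := ha a le_rfl
    have := ha (a + 1) (by omega)
    simp only [f]
    omega)
  refine ⟨lam, hl 0, fun i => ?_⟩
  have h3 := hμ i; have h4 := hν i
  rw [hl]
  simp only [f]
  omega

theorem exists_localRule_lower {μ ν lam : YoungDiagram} (hμ : IsHorizontalStrip μ lam)
    (hν : IsHorizontalStrip ν lam) :
    ∃ κ, LocalRule μ ν κ lam (lam.rowLen 0 - max (μ.rowLen 0) (ν.rowLen 0)) := by
  obtain ⟨a, ha⟩ := μ.exists_rowLen_eq_zero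
  let f : ℕ → ℕ := fun i =>
    max (μ.rowLen (i + 1)) (ν.rowLen (i + 1)) + min (μ.rowLen i) (ν.rowLen i) - lam.rowLen (i + 1)
  have hf : Antitone f := by
    refine antitone_nat_of_succ_le fun i => ?_
    have h3 := hμ i; have h4 := hν i; have h5 := hμ (i + 1); have h6 := hν (i + 1)
    have h7 := hμ (i + 1 + 1); have h8 := hν (i + 1 + 1)
    simp only [f]
    omega
  obtain ⟨κ, hl⟩ := exists_rowLen_eq hf (n := a) (by
    have h3 := hμ a; have h4 := hν a; have := ha a le_rfl
    have h5 := hμ (a + 1); have h6 := hν (a + 1)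
    have := ha (a + 1) (by omega)
    simp only [f]
    omega)
  refine ⟨κ, ?_, fun i => ?_⟩
  · have h3 := hμ 0; have h4 := hν 0
    omega
  · have h3 := hμ i; have h4 := hν i; have h5 := hμ (i + 1); have h6 := hν (i + 1)
    rw [hl]
    simp only [f]
    omega

theorem LocalRule.upper_unique {μ ν κ lam lam' : YoungDiagram} {k : ℕ}
    (h : LocalRule μ ν κ lam k) (h' : LocalRule μ ν κ lam' k) : lam = lam' := by
  refine eq_of_rowLen_eq ?_
  rintro (_ | i)
  · rw [h.1, h'.1]
  · have := h.2 i; have := h'.2 i; omega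

theorem LocalRule.lower_unique {μ ν κ κ' lam : YoungDiagram} {k k' : ℕ}
    (h : LocalRule μ ν κ lam k) (h' : LocalRule μ ν κ' lam k') : k = k' ∧ κ = κ' := by
  refine ⟨?_, eq_of_rowLen_eq fun i => ?_⟩
  · have := h.1; have := h'.1; omega
  · have := h.2 i; have := h'.2 i; omega

end YoungDiagram

/-! ### Branching rule and Pieri's rule -/

namespace SymFamily

open YoungDiagram

variable {R : Type*} [CommRing R]

/-- The Schur polynomial of `μ` in `N` variables, evaluated at `x 0, …, x (N - 1)`. -/
noncomputable def schurEval (N : ℕ) (x : ℕ → R) (μ : YoungDiagram) : R :=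
  ∑ T : BoundedTableau N μ, ∏ c ∈ μ.cells, x (T.1 c.1 c.2)

/-- The shape formed by the entries smaller than `N` of a tableau. -/
def shapeLT {μ : YoungDiagram} (N : ℕ) (T : SemistandardYoungTableau μ) : YoungDiagram where
  cells := μ.cells.filter fun c => T c.1 c.2 < N
  isLowerSet := by
    rintro ⟨i, j⟩ ⟨i', j'⟩ ⟨hi, hj⟩ h
    simp only [Finset.coe_filter, mem_cells, Set.mem_ofPred_eq] at h hi hj ⊢
    refine ⟨μ.up_left_mem hi hj h.1, ?_⟩
    exact ((T.row_weak_of_le hj (μ.up_left_mem hi le_rfl h.1)).trans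
      (T.col_weak hi h.1)).trans_lt h.2

theorem mem_shapeLT {μ : YoungDiagram} {N : ℕ} {T : SemistandardYoungTableau μ} {i j : ℕ} :
    (i, j) ∈ shapeLT N T ↔ (i, j) ∈ μ ∧ T i j < N := by
  change (i, j) ∈ μ.cells.filter (fun c => T c.1 c.2 < N) ↔ _
  simp

theorem isHorizontalStrip_iff {ν μ : YoungDiagram} :
    IsHorizontalStrip ν μ ↔ ν ≤ μ ∧ ∀ i j, (i + 1, j) ∈ μ → (i, j) ∈ ν := by
  constructor
  · intro h
    refine ⟨h.le, fun i j hj => ?_⟩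
    rw [mem_iff_lt_rowLen] at hj ⊢
    exact hj.trans_le (h i).2
  · rintro ⟨h1, h2⟩ i
    simp only [mem_iff_lt_rowLen] at h2
    refine ⟨?_, le_of_forall_lt fun j => h2 i j⟩
    refine le_of_forall_lt fun j hj => ?_
    rw [← mem_iff_lt_rowLen] at hj ⊢
    exact h1 hj

/-- Entries are at most `N` and columns increase strictly, so any cell with another one below it has
an entry smaller than `N`. -/
theorem isHorizontalStrip_shapeLT {μ : YoungDiagram} {N : ℕ} (T : BoundedTableau (N + 1) μ) :
    IsHorizontalStrip (shapeLT N T.1) μ := by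
  refine isHorizontalStrip_iff.2 ⟨?_, fun i j h => ?_⟩
  · rintro ⟨i, j⟩ h
    exact (mem_shapeLT.1 h).1
  · refine mem_shapeLT.2 ⟨μ.up_left_mem (Nat.le_succ i) le_rfl h, ?_⟩
    have h1 := T.1.col_strict (Nat.lt_add_one i) h
    have h2 := T.2 _ ((mem_cells _).2 h)
    simp only at h2
    omega

/-- Extend a tableau with entries smaller than `N` by a horizontal strip of entries `N`. -/
def extendTableau {ν μ : YoungDiagram} {N : ℕ} (h : IsHorizontalStrip ν μ)
    (T : BoundedTableau N ν) : BoundedTableau (N + 1) μ :=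
  ⟨{ entry := fun i j => if (i, j) ∈ ν then T.1 i j else if (i, j) ∈ μ then N else 0
     row_weak' := by
      intro i j1 j2 hj hc
      by_cases h2 : (i, j2) ∈ ν
      · rw [if_pos h2, if_pos (ν.up_left_mem le_rfl hj.le h2)]
        exact T.1.row_weak hj h2
      · rw [if_neg h2, if_pos hc, if_pos (μ.up_left_mem le_rfl hj.le hc)]
        split_ifs with h1
        · exact (T.2 _ ((mem_cells _).2 h1)).le
        · exact le_rfl
     col_strict' := by
      intro i1 i2 j hi hc
      have h1 : (i1, j) ∈ ν :=
        (isHorizontalStrip_iff.1 h).2 i1 j (μ.up_left_mem (Nat.succ_le_of_lt hi) le_rfl hc)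
      rw [if_pos h1]
      split_ifs with h2
      · exact T.1.col_strict hi h2
      · exact T.2 _ ((mem_cells _).2 h1)
     zeros' := by
      intro i j hc
      rw [if_neg fun h1 => hc (h.le h1), if_neg hc] },
    by
      rintro ⟨i, j⟩ hc
      change (if (i, j) ∈ ν then T.1 i j else if (i, j) ∈ μ then N else 0) < N + 1
      split_ifs with h1
      · exact (T.2 _ ((mem_cells _).2 h1)).trans (Nat.lt_succ_self N)
      · exact Nat.lt_succ_self N
      · exact Nat.succ_pos N⟩

theorem extendTableau_apply {ν μ : YoungDiagram} {N : ℕ} (h : IsHorizontalStrip ν μ)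
    (T : BoundedTableau N ν) (i j : ℕ) :
    (extendTableau h T).1 i j = if (i, j) ∈ ν then T.1 i j else if (i, j) ∈ μ then N else 0 :=
  rfl

theorem shapeLT_extendTableau {ν μ : YoungDiagram} {N : ℕ} (h : IsHorizontalStrip ν μ)
    (T : BoundedTableau N ν) : shapeLT N (extendTableau h T).1 = ν := by
  ext ⟨i, j⟩
  rw [mem_cells, mem_cells, mem_shapeLT, extendTableau_apply]
  constructor
  · rintro ⟨h1, h2⟩
    by_contra h3
    rw [if_neg h3, if_pos h1] at h2
    exact lt_irrefl _ h2
  · intro h1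
    rw [if_pos h1]
    exact ⟨h.le h1, T.2 _ ((mem_cells _).2 h1)⟩

theorem extendTableau_injective {ν μ : YoungDiagram} {N : ℕ} (h : IsHorizontalStrip ν μ) :
    Function.Injective (extendTableau (N := N) h) := by
  intro T T' hT
  refine Subtype.ext (SemistandardYoungTableau.ext fun i j => ?_)
  by_cases hc : (i, j) ∈ ν
  · have : (extendTableau h T).1 i j = (extendTableau h T').1 i j := by rw [hT]
    simpa only [extendTableau_apply, if_pos hc] using this
  · rw [T.1.zeros hc, T'.1.zeros hc]

theorem exists_extendTableau_eq {μ : YoungDiagram} {N : ℕ} (T : BoundedTableau (N + 1) μ) :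
    ∃ T', extendTableau (isHorizontalStrip_shapeLT T) T' = T := by
  refine ⟨⟨{ entry := fun i j => if (i, j) ∈ shapeLT N T.1 then T.1 i j else 0
             row_weak' := ?_
             col_strict' := ?_
             zeros' := fun hc => if_neg hc }, ?_⟩, ?_⟩
  · intro i j1 j2 hj hc
    rw [if_pos hc, if_pos ((shapeLT N T.1).up_left_mem le_rfl hj.le hc)]
    exact T.1.row_weak hj (mem_shapeLT.1 hc).1
  · intro i1 i2 j hi hc
    rw [if_pos hc, if_pos ((shapeLT N T.1).up_left_mem hi.le le_rfl hc)]
    exact T.1.col_strict hi (mem_shapeLT.1 hc).1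
  · rintro ⟨i, j⟩ hc
    rw [mem_cells] at hc
    change (if (i, j) ∈ shapeLT N T.1 then T.1 i j else 0) < N
    rw [if_pos hc]
    exact (mem_shapeLT.1 hc).2
  · refine Subtype.ext (SemistandardYoungTableau.ext fun i j => ?_)
    rw [extendTableau_apply]
    change (if (i, j) ∈ shapeLT N T.1 then (if (i, j) ∈ shapeLT N T.1 then T.1 i j else 0)
      else if (i, j) ∈ μ then N else 0) = T.1 i j
    split_ifs with h1 h2
    · rfl
    · have h3 := T.2 _ ((mem_cells _).2 h2)
      simp only at h3
      rw [mem_shapeLT] at h1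
      have : ¬ T.1 i j < N := fun h => h1 ⟨h2, h⟩
      omega
    · exact (T.1.zeros h2).symm

theorem prod_extendTableau {ν μ : YoungDiagram} {N : ℕ} (x : ℕ → R) (h : IsHorizontalStrip ν μ)
    (T : BoundedTableau N ν) :
    ∏ c ∈ μ.cells, x ((extendTableau h T).1 c.1 c.2) =
      x N ^ (μ.card - ν.card) * ∏ c ∈ ν.cells, x (T.1 c.1 c.2) := by
  have hsub := cells_subset_iff.2 h.le
  rw [← Finset.prod_sdiff hsub]
  congr 1
  · rw [Finset.prod_eq_pow_card (b := x N), Finset.card_sdiff_of_subset hsub]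
    rintro ⟨i, j⟩ hc
    rw [Finset.mem_sdiff, mem_cells, mem_cells] at hc
    rw [extendTableau_apply, if_neg hc.2, if_pos hc.1]
  · refine Finset.prod_congr rfl ?_
    rintro ⟨i, j⟩ hc
    rw [extendTableau_apply, if_pos ((mem_cells _).1 hc)]

/-- The branching rule for Schur polynomials. -/
theorem schurEval_succ (N : ℕ) (x : ℕ → R) (μ : YoungDiagram) :
    schurEval (N + 1) x μ =
      ∑ ν ∈ removeStrip μ, x N ^ (μ.card - ν.card) * schurEval N x ν := by
  classical
  -- Tableaux are grouped by the shape of their entries below `N`; the remaining cells all contain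
  -- `N`.
  rw [schurEval, ← Finset.sum_fiberwise_of_maps_to (s := Finset.univ) (t := removeStrip μ)
    (g := fun T : BoundedTableau (N + 1) μ => shapeLT N T.1)
    fun T _ => mem_removeStrip.2 (isHorizontalStrip_shapeLT T)]
  refine Finset.sum_congr rfl fun ν hν => ?_
  have h := mem_removeStrip.1 hν
  rw [schurEval, Finset.mul_sum]
  symm
  refine Finset.sum_bij (fun T _ => extendTableau h T) ?_ ?_ ?_ ?_
  · intro T _
    simp [shapeLT_extendTableau]
  · intro T _ T' _ hT
    exact extendTableau_injective h hT
  · intro T hT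
    obtain rfl := (Finset.mem_filter.1 hT).2
    obtain ⟨T', hT'⟩ := exists_extendTableau_eq T
    exact ⟨T', Finset.mem_univ _, hT'⟩
  · intro T _
    exact (prod_extendTableau x h T).symm

theorem schurEval_zero (x : ℕ → R) {μ : YoungDiagram} (h : μ.card ≠ 0) :
    schurEval 0 x μ = 0 := by
  obtain ⟨c, hc⟩ := Finset.card_ne_zero.1 h
  have : IsEmpty (BoundedTableau 0 μ) := ⟨fun T => Nat.not_lt_zero _ (T.2 c hc)⟩
  simp [schurEval]

theorem schurEval_bot (N : ℕ) (x : ℕ → R) : schurEval N x ⊥ = 1 := by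
  have : Unique (BoundedTableau N ⊥) :=
    { default := ⟨SemistandardYoungTableau.highestWeight ⊥, by simp⟩
      uniq := fun T => Subtype.ext (SemistandardYoungTableau.ext fun i j => by
        rw [T.1.zeros (notMem_bot _), SemistandardYoungTableau.zeros _ (notMem_bot _)]) }
  rw [schurEval, Finset.sum_eq_single_of_mem default (Finset.mem_univ _)
    fun T _ hT => absurd (Subsingleton.elim T default) hT]
  simp

/-- The complete homogeneous symmetric polynomial of degree `r` in `x 0, …, x (N - 1)`. -/
def hEval (x : ℕ → R) : ℕ → ℕ → R
  | 0, r => if r = 0 then 1 else 0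
  | N + 1, r => ∑ k ∈ Finset.range (r + 1), x N ^ k * hEval x N (r - k)

/-- **Pieri's rule** for Schur polynomials. -/
theorem hEval_mul_schurEval (N r : ℕ) (x : ℕ → R) (μ : YoungDiagram) :
    hEval x N r * schurEval N x μ = ∑ lam ∈ addStrip μ r, schurEval N x lam := by
  induction N generalizing r μ with
  | zero =>
    rcases Nat.eq_zero_or_pos r with rfl | hr
    · simp [hEval, addStrip_zero]
    · rw [hEval, if_neg hr.ne', zero_mul, Finset.sum_eq_zero]
      -- Without variables only the empty diagram has a nonzero Schur polynomial, and `lam` has at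
      -- least `r > 0` cells.
      intro lam h
      have := (mem_addStrip.1 h).2
      exact schurEval_zero x (by omega)
  | succ N ih =>
    have hL : hEval x (N + 1) r * schurEval (N + 1) x μ =
        ∑ q ∈ (Finset.range (r + 1) ×ˢ removeStrip μ).sigma fun a => addStrip a.2 (r - a.1),
          x N ^ (q.1.1 + (μ.card - q.1.2.card)) * schurEval N x q.2 := by
      rw [Finset.sum_sigma, schurEval_succ, hEval, Finset.sum_mul_sum, ← Finset.sum_product']
      refine Finset.sum_congr rfl fun a _ => ?_
      dsimp only
      rw [← Finset.mul_sum, ← ih, pow_add]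
      ring
    have hR : ∑ lam ∈ addStrip μ r, schurEval (N + 1) x lam =
        ∑ q ∈ (addStrip μ r).sigma fun lam => removeStrip lam,
          x N ^ (q.1.card - q.2.card) * schurEval N x q.2 := by
      rw [Finset.sum_sigma]
      exact Finset.sum_congr rfl fun lam _ => schurEval_succ N x lam
    rw [hL, hR]
    -- Both sides are now sums of `schurEval N x ν`: the left over `(k, κ, ν)`, the right over
    -- `(lam, ν)`. With `μ` and `ν` fixed, the local rule matches `(k, κ)` with `lam`.
    have up : ∀ q ∈ (Finset.range (r + 1) ×ˢ removeStrip μ).sigma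
        (fun a => addStrip a.2 (r - a.1)), ∃ lam, LocalRule μ q.2 q.1.2 lam q.1.1 := by
      intro q hq
      simp only [Finset.mem_sigma, Finset.mem_product, mem_removeStrip, mem_addStrip] at hq
      exact exists_localRule_upper _ hq.1.2 hq.2.1
    choose! f hf using up
    refine Finset.sum_bij (fun q _ => (⟨f q, q.2⟩ : Σ _ : YoungDiagram, YoungDiagram)) ?_ ?_ ?_ ?_
    · intro q hq
      have hrule := hf q hq
      have hcard := hrule.card_add_card
      simp only [Finset.mem_sigma, Finset.mem_product, mem_removeStrip, mem_addStrip,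
        Finset.mem_range] at hq ⊢
      obtain ⟨h1, h2⟩ := hrule.isHorizontalStrip_upper hq.1.2 hq.2.1
      exact ⟨⟨h1, by omega⟩, h2⟩
    · intro q hq q' hq' h
      have hrule := hf q hq
      have hrule' := hf q' hq'
      obtain ⟨⟨k, κ⟩, ν⟩ := q
      obtain ⟨⟨k', κ'⟩, ν'⟩ := q'
      simp only [Sigma.mk.injEq, heq_eq_eq] at h
      obtain ⟨h1, rfl⟩ := h
      rw [← h1] at hrule'
      obtain ⟨rfl, rfl⟩ := hrule.lower_unique hrule'
      rfl
    · rintro ⟨lam, ν⟩ hq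
      simp only [Finset.mem_sigma, mem_removeStrip, mem_addStrip] at hq
      obtain ⟨κ, hκ⟩ := exists_localRule_lower hq.1.1 hq.2
      set k := lam.rowLen 0 - max (μ.rowLen 0) (ν.rowLen 0)
      obtain ⟨h1, h2⟩ := hκ.isHorizontalStrip_lower hq.1.1 hq.2
      have hcard := hκ.card_add_card
      have := card_le_card h2.le
      have hmem : (⟨(k, κ), ν⟩ : Σ _ : ℕ × YoungDiagram, YoungDiagram) ∈
          (Finset.range (r + 1) ×ˢ removeStrip μ).sigma (fun a => addStrip a.2 (r - a.1)) := by
        simp only [Finset.mem_sigma, Finset.mem_product, mem_removeStrip, mem_addStrip,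
          Finset.mem_range]
        exact ⟨⟨by omega, h1⟩, h2, by omega⟩
      refine ⟨⟨(k, κ), ν⟩, hmem, ?_⟩
      rw [(hf _ hmem).upper_unique hκ]
    · intro q hq
      have hcard := (hf q hq).card_add_card
      simp only [Finset.mem_sigma, Finset.mem_product, mem_removeStrip, mem_addStrip,
        Finset.mem_range] at hq
      have := card_le_card hq.1.2.le
      have := card_le_card hq.2.1.le
      dsimp only
      congr 2
      omega

end SymFamily

/-! ### Symmetric functions of degree two and Schur-positivity -/

namespace SymFamily

open YoungDiagram

variable {R : Type*} [CommRing R]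

theorem hEval_deg_zero (x : ℕ → R) (N : ℕ) : hEval x N 0 = 1 := by
  induction N with
  | zero => simp [hEval]
  | succ N ih => simp [hEval, ih]

theorem hEval_deg_one (x : ℕ → R) (N : ℕ) : hEval x N 1 = ∑ i ∈ Finset.range N, x i := by
  induction N with
  | zero => simp [hEval]
  | succ N ih => simp [hEval, Finset.sum_range_succ, ih, hEval_deg_zero]

/-- Serves to identify the recursive `hEval` with `h 2`, by comparing both with power sums. -/
theorem two_mul_hEval_deg_two (x : ℕ → R) (N : ℕ) :
    2 * hEval x N 2 = (∑ i ∈ Finset.range N, x i) ^ 2 + ∑ i ∈ Finset.range N, x i ^ 2 := by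
  induction N with
  | zero => simp [hEval]
  | succ N ih =>
    have : hEval x (N + 1) 2 = hEval x N 2 + x N * hEval x N 1 + x N ^ 2 := by
      simp [hEval, Finset.sum_range_succ, hEval_deg_zero]
    rw [this, hEval_deg_one, Finset.sum_range_succ, Finset.sum_range_succ]
    linear_combination ih

/-- The variables of `MvPolynomial (Fin N) ℤ`, continued by zero. -/
noncomputable def extX (N : ℕ) (i : ℕ) : MvPolynomial (Fin N) ℤ :=
  if h : i < N then X ⟨i, h⟩ else 0

theorem schur_apply (μ : YoungDiagram) (N : ℕ) : schur μ N = schurEval N (extX N) μ := by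
  refine Finset.sum_congr rfl fun T _ => ?_
  refine Eq.trans ?_ (Finset.prod_coe_sort μ.cells fun c => extX N (T.1 c.1 c.2))
  refine Finset.prod_congr rfl fun c _ => ?_
  rw [extX, dif_pos (T.2 c.1 c.2)]

theorem sum_extX_pow (N k : ℕ) :
    ∑ i ∈ Finset.range N, extX N i ^ k = psum (Fin N) ℤ k := by
  rw [Finset.sum_range, psum]
  refine Finset.sum_congr rfl fun i _ => ?_
  rw [extX, dif_pos i.2]

theorem h_one_apply (N : ℕ) : h 1 N = psum (Fin N) ℤ 1 := by
  rw [h, hsymm_one, psum_one]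

/-- The pairs with `q.1 ≤ q.2` and those with `q.2 ≤ q.1` together cover all pairs, the diagonal
twice; the diagonal contributes `p_2`. -/
theorem two_mul_h_two_apply (N : ℕ) :
    2 * h 2 N = psum (Fin N) ℤ 1 ^ 2 + psum (Fin N) ℤ 2 := by
  have h1 : h 2 N = ∑ q : Fin N × Fin N with q.1 ≤ q.2, X q.1 * X q.2 := by
    rw [h, hsymm, ← Equiv.sum_comp (Sym2.equivSym (Fin N)),
      ← Equiv.sum_comp (Sym2.sortEquiv (α := Fin N)).symm, ← Finset.sum_subtype_eq_sum_filter,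
      Finset.subtype_univ]
    refine Finset.sum_congr rfl fun q _ => ?_
    change (Multiset.map X (q.1.1 ::ₘ q.1.2 ::ₘ 0)).prod = _
    simp
  have h2 : ∑ q : Fin N × Fin N with q.2 ≤ q.1, (X q.1 * X q.2 : MvPolynomial (Fin N) ℤ) =
      h 2 N := by
    rw [h1]
    refine Finset.sum_equiv (Equiv.prodComm _ _) (by simp) fun q _ => ?_
    exact mul_comm _ _
  have h3 : psum (Fin N) ℤ 1 ^ 2 =
      ∑ q : Fin N × Fin N, (X q.1 * X q.2 : MvPolynomial (Fin N) ℤ) := by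
    rw [psum_one, sq, Fintype.sum_mul_sum, ← Finset.sum_product', Finset.univ_product_univ]
  have h4 : psum (Fin N) ℤ 2 =
      ∑ q : Fin N × Fin N with q.1 = q.2, (X q.1 * X q.2 : MvPolynomial (Fin N) ℤ) := by
    rw [Finset.sum_filter, Fintype.sum_prod_type]
    simp [psum, sq]
  rw [two_mul]
  nth_rewrite 1 [h1]
  rw [← h2, h3, h4]
  simp only [Finset.sum_filter, ← Finset.sum_add_distrib]
  refine Finset.sum_congr rfl fun q _ => ?_
  rcases lt_trichotomy q.1 q.2 with hq | hq | hq
  · simp [hq.le, hq.ne, not_le.2 hq]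
  · simp [hq]
  · simp [hq.le, hq.ne', not_le.2 hq]

/-- Newton's identity in degree 2. -/
theorem two_mul_e_two_apply (N : ℕ) :
    2 * e 2 N = psum (Fin N) ℤ 1 ^ 2 - psum (Fin N) ℤ 2 := by
  have := mul_esymm_eq_sum (Fin N) ℤ 2
  have hs : Finset.HasAntidiagonal.antidiagonal 2 = {(0, 2), (1, 1), (2, 0)} := rfl
  rw [hs] at this
  simp [Finset.filter_insert, Finset.filter_singleton] at this
  rw [e, this, psum_one]
  ring

theorem psum_one_sq_apply (N : ℕ) : psum (Fin N) ℤ 1 ^ 2 = h 2 N + e 2 N := by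
  refine mul_left_cancel₀ (two_ne_zero (α := MvPolynomial (Fin N) ℤ)) ?_
  linear_combination -two_mul_h_two_apply N - two_mul_e_two_apply N

theorem psum_two_apply (N : ℕ) : psum (Fin N) ℤ 2 = h 2 N - e 2 N := by
  refine mul_left_cancel₀ (two_ne_zero (α := MvPolynomial (Fin N) ℤ)) ?_
  linear_combination -two_mul_h_two_apply N + two_mul_e_two_apply N

theorem h_one_sq : h 1 ^ 2 = h 2 + e 2 := by
  funext N
  simp only [Pi.pow_apply, Pi.add_apply, h_one_apply, psum_one_sq_apply]

theorem h_one_mul_schur (μ : YoungDiagram) :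
    h 1 * schur μ = ∑ lam ∈ addStrip μ 1, schur lam := by
  funext N
  have := hEval_mul_schurEval N 1 (extX N) μ
  have h1 := sum_extX_pow N 1
  simp only [pow_one] at h1
  rw [hEval_deg_one, h1, ← h_one_apply] at this
  simp only [Pi.mul_apply, Finset.sum_apply, schur_apply, this]

theorem h_two_mul_schur (μ : YoungDiagram) :
    h 2 * schur μ = ∑ lam ∈ addStrip μ 2, schur lam := by
  funext N
  have h1 := sum_extX_pow N 1
  simp only [pow_one] at h1
  have h2 : hEval (extX N) N 2 = h 2 N := by
    refine mul_left_cancel₀ (two_ne_zero (α := MvPolynomial (Fin N) ℤ)) ?_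
    rw [two_mul_hEval_deg_two, two_mul_h_two_apply, h1, sum_extX_pow]
  have := hEval_mul_schurEval N 2 (extX N) μ
  rw [h2] at this
  simp only [Pi.mul_apply, Finset.sum_apply, schur_apply, this]

/-- The cell is added in the first row `i` where `lam` is longer than `μ`. If `i > 0`, then `μ_i <
lam_i ≤ lam_(i-1) ≤ μ_(i-1)`, so the result is a diagram; lying between `μ` and `lam`, it inherits
the strip conditions. -/
theorem exists_mem_addStrip_one {μ lam : YoungDiagram} {r : ℕ} (hl : lam ∈ addStrip μ (r + 1)) :
    ∃ ν ∈ addStrip μ 1, lam ∈ addStrip ν r := by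
  classical
  simp only [mem_addStrip] at hl ⊢
  obtain ⟨hs, hc⟩ := hl
  have hex : ∃ i, μ.rowLen i < lam.rowLen i := by
    by_contra! hcon
    have := card_le_card (le_of_rowLen_le hcon)
    omega
  have hi := Nat.find_spec hex
  have hmin : ∀ j < Nat.find hex, lam.rowLen j ≤ μ.rowLen j :=
    fun j hj => not_lt.1 (Nat.find_min hex hj)
  generalize Nat.find hex = i at hi hmin
  obtain ⟨a, ha⟩ := μ.exists_rowLen_eq_zero
  have hf : Antitone fun j => μ.rowLen j + if j = i then 1 else 0 := by
    refine antitone_nat_of_succ_le fun j => ?_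
    have h1 := μ.rowLen_anti j (j + 1) (Nat.le_succ j)
    by_cases hj : j + 1 = i
    · subst hj
      have h2 := hmin j (Nat.lt_succ_self j)
      have h3 := lam.rowLen_anti j (j + 1) (Nat.le_succ j)
      simp only [if_true]
      omega
    · rw [if_neg hj]
      omega
  obtain ⟨ν, hν⟩ := exists_rowLen_eq hf (n := a + i + 1) (by
    rw [ha _ (by omega), if_neg (by omega)])
  have hcard : ν.card = μ.card + 1 := by
    rw [μ.card_eq_sum_rowLen (n := a + i + 1) fun j hj => ha j (by omega),
      ν.card_eq_sum_rowLen (n := a + i + 1) fun j hj => by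
        rw [hν, ha _ (by omega), if_neg (by omega)]]
    simp only [hν, Finset.sum_add_distrib, Finset.sum_ite_eq', Finset.mem_range]
    rw [if_pos (by omega)]
  have hνl : ∀ j, μ.rowLen j ≤ ν.rowLen j ∧ ν.rowLen j ≤ lam.rowLen j := by
    intro j
    have := (hs j).1
    rw [hν]
    split_ifs with h
    · subst h
      omega
    · omega
  refine ⟨ν, ⟨fun j => ⟨(hνl j).1, (hνl (j + 1)).2.trans (hs j).2⟩, hcard⟩,
    fun j => ⟨(hνl j).2, (hs j).2.trans (hνl j).1⟩, by omega⟩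

/-- The vertical analogue of Pieri's rule in degree `2`, in qualitative form: `e 2 * schur μ` is
what remains of `h 1 * (h 1 * schur μ)` after the removal of `h 2 * schur μ`. -/
theorem e_two_mul_schur (μ : YoungDiagram) :
    ∃ s : Multiset YoungDiagram, e 2 * schur μ = (s.map schur).sum := by
  classical
  let s : Multiset YoungDiagram := (addStrip μ 1).val.bind fun ν => (addStrip ν 1).val
  have hs : (addStrip μ 2).val ≤ s := by
    -- A diagram occurs at most once in `h 2 * schur μ`, so mere membership in `s` is enough.
    rw [Multiset.le_iff_subset (addStrip μ 2).nodup]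
    intro lam hl
    obtain ⟨ν, h1, h2⟩ := exists_mem_addStrip_one hl
    exact Multiset.mem_bind.2 ⟨ν, h1, h2⟩
  obtain ⟨t, ht⟩ := Multiset.le_iff_exists_add.1 hs
  refine ⟨t, ?_⟩
  have h1 : h 1 * (h 1 * schur μ) = (s.map schur).sum := by
    rw [h_one_mul_schur, Finset.mul_sum, Multiset.map_bind, Multiset.sum_bind]
    simp only [h_one_mul_schur]
    rfl
  have h2 : h 2 * schur μ = ((addStrip μ 2).val.map schur).sum := h_two_mul_schur μ
  rw [ht, Multiset.map_add, Multiset.sum_add, ← h2] at h1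
  linear_combination h1 - schur μ * h_one_sq

theorem IsSchurPositive.zero : IsSchurPositive 0 := ⟨0, by simp⟩

theorem IsSchurPositive.add {f g : SymFamily} (hf : IsSchurPositive f) (hg : IsSchurPositive g) :
    IsSchurPositive (f + g) := by
  classical
  obtain ⟨c, rfl⟩ := hf
  obtain ⟨d, rfl⟩ := hg
  exact ⟨c + d, (Finsupp.sum_add_index' (by simp) (by simp [add_smul])).symm⟩

theorem isSchurPositive_schur (μ : YoungDiagram) : IsSchurPositive (schur μ) :=
  ⟨Finsupp.single μ 1, by simp⟩

theorem IsSchurPositive.sum {ι : Type*} {s : Finset ι} {f : ι → SymFamily}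
    (hf : ∀ i ∈ s, IsSchurPositive (f i)) : IsSchurPositive (∑ i ∈ s, f i) :=
  Finset.sum_induction f IsSchurPositive (fun _ _ => IsSchurPositive.add) .zero hf

theorem IsSchurPositive.nsmul {f : SymFamily} (hf : IsSchurPositive f) (n : ℕ) :
    IsSchurPositive (n • f) := by
  rw [← Finset.card_range n, ← Finset.sum_const]
  exact .sum fun _ _ => hf

theorem isSchurPositive_multiset_sum (s : Multiset YoungDiagram) :
    IsSchurPositive (s.map schur).sum := by
  induction s using Multiset.induction with
  | empty => simpa using IsSchurPositive.zero
  | cons μ s ih =>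
    rw [Multiset.map_cons, Multiset.sum_cons]
    exact (isSchurPositive_schur μ).add ih

theorem IsSchurPositive.mul_of_forall_schur {f g : SymFamily} (hf : IsSchurPositive f)
    (hg : ∀ μ, IsSchurPositive (g * schur μ)) : IsSchurPositive (g * f) := by
  obtain ⟨c, rfl⟩ := hf
  rw [Finsupp.sum, Finset.mul_sum]
  refine .sum fun μ _ => ?_
  rw [mul_smul_comm]
  exact (hg μ).nsmul _

theorem IsSchurPositive.h_two_mul {f : SymFamily} (hf : IsSchurPositive f) :
    IsSchurPositive (h 2 * f) :=
  hf.mul_of_forall_schur fun μ => h_two_mul_schur μ ▸ .sum fun lam _ => isSchurPositive_schur lam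

theorem IsSchurPositive.e_two_mul {f : SymFamily} (hf : IsSchurPositive f) :
    IsSchurPositive (e 2 * f) :=
  hf.mul_of_forall_schur fun μ => by
    obtain ⟨s, hs⟩ := e_two_mul_schur μ
    exact hs ▸ isSchurPositive_multiset_sum s

theorem isSchurPositive_one : IsSchurPositive 1 := by
  have : schur ⊥ = 1 := by
    funext N
    rw [schur_apply, schurEval_bot, Pi.one_apply]
  exact this ▸ isSchurPositive_schur ⊥

theorem isSchurPositive_h_two_pow_mul_e_two_pow (a b : ℕ) :
    IsSchurPositive (h 2 ^ a * e 2 ^ b) := by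
  induction a with
  | zero =>
    induction b with
    | zero => simpa using isSchurPositive_one
    | succ b ih =>
      rw [pow_zero, one_mul] at ih ⊢
      exact pow_succ' (e 2) b ▸ ih.e_two_mul
  | succ a ih =>
    rw [pow_succ', mul_assoc]
    exact ih.h_two_mul

end SymFamily

/-! ### The interval below `(2^m)` -/

namespace RevLex

theorem part_eq_of_sorted {n : ℕ} {lam : n.Partition} {l : List ℕ} (hl : l.Pairwise (· ≥ ·))
    (h : lam.parts = (l : Multiset ℕ)) (i : ℕ) : part lam i = l.getD i 0 := by
  rw [part, h, Multiset.coe_sort, List.mergeSort_eq_self]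
  exact hl

theorem le_part_zero {n : ℕ} {lam : n.Partition} {a : ℕ} (ha : a ∈ lam.parts) :
    a ≤ part lam 0 := by
  have hs : (lam.parts.sort (· ≥ ·)).Pairwise (· ≥ ·) := Multiset.pairwise_sort _ _
  rw [← Multiset.mem_sort (r := (· ≥ ·))] at ha
  rw [part]
  generalize lam.parts.sort (· ≥ ·) = l at hs ha
  match l, hs, ha with
  | b :: l, hs, ha =>
    rw [List.getD_cons_zero]
    rcases List.mem_cons.1 ha with rfl | h
    · exact le_rfl
    · exact List.rel_of_pairwise_cons hs h

end RevLex

/-- The partition `(2^i, 1^(2m-2i))` of `2 * m`. -/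
def twosOnesPartition (m : ℕ) (i : Fin (m + 1)) : (2 * m).Partition where
  parts := Multiset.replicate i 2 + Multiset.replicate (2 * (m - i)) 1
  parts_pos := fun hi => by
    rcases Multiset.mem_add.1 hi with h | h <;> rw [Multiset.eq_of_mem_replicate h] <;> norm_num
  parts_sum := by
    have := i.2
    simp
    omega

namespace RevLex

theorem part_twosOnesPartition (m : ℕ) (i : Fin (m + 1)) (j : ℕ) :
    part (twosOnesPartition m i) j = if j < i then 2 else if j < 2 * m - i then 1 else 0 := by
  rw [part_eq_of_sorted (l := List.replicate i 2 ++ List.replicate (2 * (m - i)) 1)]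
  · have := i.2
    simp only [List.getD_eq_getElem?_getD, List.getElem?_append, List.getElem?_replicate,
      List.length_replicate]
    split_ifs <;> first | rfl | omega
  · simp only [List.pairwise_append, List.pairwise_replicate, List.mem_replicate]
    refine ⟨by simp, by simp, ?_⟩
    rintro a ⟨_, rfl⟩ b ⟨_, rfl⟩
    norm_num
  · rfl

end RevLex

theorem onesPartition_eq (m : ℕ) : onesPartition (2 * m) = twosOnesPartition m 0 := by
  ext1
  simp [onesPartition, twosOnesPartition]

theorem twosPartition_eq (m : ℕ) : twosPartition m = twosOnesPartition m (Fin.last m) := by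
  ext1
  simp [twosPartition, twosOnesPartition]

theorem exists_twosOnesPartition_eq {m : ℕ} {lam : (2 * m).Partition}
    (h : ∀ a ∈ lam.parts, a ≤ 2) : ∃ i, twosOnesPartition m i = lam := by
  have key : lam.parts = Multiset.replicate (lam.parts.count 2) 2 +
      Multiset.replicate (lam.parts.count 1) 1 := by
    ext a
    rw [Multiset.count_add, Multiset.count_replicate, Multiset.count_replicate]
    by_cases ha : a ∈ lam.parts
    · have h1 := h a ha
      have h2 := lam.parts_pos ha
      have : a = 1 ∨ a = 2 := by omega
      rcases this with rfl | rfl <;> simp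
    · rw [Multiset.count_eq_zero_of_notMem ha]
      split_ifs with h1 h2 h2
      · omega
      · subst h1
        simp [Multiset.count_eq_zero_of_notMem ha]
      · subst h2
        simp [Multiset.count_eq_zero_of_notMem ha]
      · rfl
  have hsum := lam.parts_sum
  rw [key] at hsum
  simp only [Multiset.sum_add, Multiset.sum_replicate, smul_eq_mul] at hsum
  refine ⟨⟨lam.parts.count 2, by omega⟩, ?_⟩
  ext1
  refine Eq.trans ?_ key.symm
  change Multiset.replicate (lam.parts.count 2) 2 +
    Multiset.replicate (2 * (m - lam.parts.count 2)) 1 = _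
  congr 2
  omega

/-- The largest part of a partition below `(2^m)` is at most 2, which leaves only parts 1 and 2.
Conversely, for `i ≠ 0` the comparison with `(1^(2m))` is decided at index 0, and for `i ≠ m` the
comparison with `(2^m)` at index `i`. -/
theorem RevLex.le_twosPartition_iff {m : ℕ} {lam : (2 * m).Partition} :
    RevLex.Le (onesPartition (2 * m)) lam ∧ RevLex.Le lam (twosPartition m) ↔
      ∃ i, twosOnesPartition m i = lam := by
  constructor
  · rintro ⟨-, h⟩
    refine exists_twosOnesPartition_eq fun a ha => (le_part_zero ha).trans ?_
    have h2 : part (twosPartition m) 0 ≤ 2 := by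
      rw [twosPartition_eq, part_twosOnesPartition]
      split_ifs <;> norm_num
    rcases h with rfl | ⟨j, h, h'⟩
    · exact h2
    · rcases Nat.eq_zero_or_pos j with rfl | hj
      · omega
      · rw [h 0 hj]
        exact h2
  · rintro ⟨i, rfl⟩
    have him := i.2
    rw [onesPartition_eq, twosPartition_eq]
    constructor
    · rcases eq_or_ne i 0 with rfl | hi
      · exact Or.inl rfl
      · have : (i : ℕ) ≠ 0 := fun h => hi (Fin.ext h)
        refine Or.inr ⟨0, fun j hj => absurd hj (Nat.not_lt_zero j), ?_⟩
        rw [part_twosOnesPartition, part_twosOnesPartition, if_pos (show 0 < (i : ℕ) by omega),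
          if_neg (by simp)]
        split_ifs <;> norm_num
    · rcases eq_or_ne i (Fin.last m) with rfl | hi
      · exact Or.inl rfl
      · have : (i : ℕ) ≠ m := fun h => hi (Fin.ext h)
        refine Or.inr ⟨i, fun j hj => ?_, ?_⟩ <;>
          rw [part_twosOnesPartition, part_twosOnesPartition, Fin.val_last]
        · rw [if_pos hj, if_pos (by omega)]
        · rw [if_neg (lt_irrefl _), if_pos (by omega)]
          split_ifs <;> omega

theorem twosOnesPartition_injective (m : ℕ) : Function.Injective (twosOnesPartition m) := by
  intro i j hij
  have := congrArg (fun lam : (2 * m).Partition => lam.parts.count 2) hij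
  simp only [twosOnesPartition, Multiset.count_add, Multiset.count_replicate] at this
  simpa [Fin.ext_iff] using this

/-! ### Closed form of `ψ` and the differences -/

namespace SymFamily

theorem p_twosOnesPartition (m : ℕ) (i : Fin (m + 1)) :
    p (twosOnesPartition m i) = (h 2 - e 2) ^ (i : ℕ) * (h 2 + e 2) ^ (m - i) := by
  funext N
  simp only [p, psumPart, twosOnesPartition, Multiset.map_add, Multiset.map_replicate,
    Multiset.prod_add, Multiset.prod_replicate, Pi.mul_apply, Pi.pow_apply, Pi.add_apply,
    Pi.sub_apply, pow_mul, psum_one_sq_apply, psum_two_apply]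

theorem psi_twosPartition (m : ℕ) :
    psi (twosPartition m) =
      ∑ i ∈ Finset.range (m + 1), (h 2 - e 2) ^ i * (h 2 + e 2) ^ (m - i) := by
  classical
  rw [psi, Finset.sum_range]
  symm
  refine Finset.sum_bij (fun i _ => twosOnesPartition m i) ?_ ?_ ?_ ?_
  · intro i _
    exact Finset.mem_filter.2 ⟨Finset.mem_univ _, RevLex.le_twosPartition_iff.2 ⟨i, rfl⟩⟩
  · intro i _ j _ hij
    exact twosOnesPartition_injective m hij
  · intro lam hlam
    obtain ⟨i, hi⟩ := RevLex.le_twosPartition_iff.1 (Finset.mem_filter.1 hlam).2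
    exact ⟨i, Finset.mem_univ _, hi⟩
  · intro i _
    exact (p_twosOnesPartition m i).symm

end SymFamily

/-- The odd part of the binomial expansion of `(a + b) ^ n`, divided by `b`. -/
def oddBinomialSum {R : Type*} [CommRing R] (a b : R) (n : ℕ) : R :=
  ∑ j ∈ Finset.range (n + 1) with Odd j, (n.choose j : R) * a ^ (n - j) * b ^ (j - 1)

theorem two_mul_mul_oddBinomialSum {R : Type*} [CommRing R] (a b : R) (n : ℕ) :
    2 * b * oddBinomialSum a b n = (a + b) ^ n - (a - b) ^ n := by
  rw [add_comm a b, sub_eq_neg_add a b, add_pow, add_pow, ← Finset.sum_sub_distrib, oddBinomialSum,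
    Finset.mul_sum, Finset.sum_filter]
  refine Finset.sum_congr rfl fun j _ => ?_
  rcases Nat.even_or_odd j with hj | hj
  · rw [if_neg (Nat.not_odd_iff_even.2 hj), hj.neg_pow, sub_self]
  · rw [if_pos hj, hj.neg_pow]
    obtain ⟨k, rfl⟩ := hj
    rw [Nat.add_sub_cancel, pow_succ]
    ring

theorem sum_sub_pow_mul_add_pow {R : Type*} [CommRing R] (a b : R) (m : ℕ) :
    ∑ i ∈ Finset.range (m + 1), (a - b) ^ i * (a + b) ^ (m - i) = oddBinomialSum a b (m + 1) := by
  -- Dividing by `2 * b` needs a domain, so the identity is proved for indeterminates and then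
  -- specialised.
  let P := MvPolynomial (Fin 2) ℤ
  have key : ∑ i ∈ Finset.range (m + 1), (X 0 - X 1 : P) ^ i * (X 0 + X 1) ^ (m - i) =
      oddBinomialSum (X 0) (X 1) (m + 1) := by
    refine mul_left_cancel₀ (mul_ne_zero (two_ne_zero (α := P)) (X_ne_zero (R := ℤ) (1 : Fin 2))) ?_
    rw [two_mul_mul_oddBinomialSum]
    have := geom_sum₂_mul (X 0 - X 1 : P) (X 0 + X 1) (m + 1)
    simp only [Nat.add_sub_cancel] at this
    linear_combination -this
  have := congrArg (aeval (R := ℤ) ![a, b]) key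
  simpa [oddBinomialSum] using this

namespace SymFamily

theorem psi_twosPartition_eq_oddBinomialSum (m : ℕ) :
    psi (twosPartition m) = oddBinomialSum (h 2) (e 2) (m + 1) := by
  rw [psi_twosPartition, sum_sub_pow_mul_add_pow]

end SymFamily

/-- The factor `a ^ k` aligns the powers of `a`; terms with `j > n - k` have a zero binomial
coefficient, so both sums share one range. Monotonicity of binomials in the upper index makes the
natural subtraction exact, hence the coefficients are visibly nonnegative. -/
theorem oddBinomialSum_sub {R : Type*} [CommRing R] (a b : R) {n k : ℕ} (hk : k ≤ n) :
    oddBinomialSum a b n - a ^ k * oddBinomialSum a b (n - k) =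
      ∑ j ∈ Finset.range (n + 1) with Odd j,
        (n.choose j - (n - k).choose j : ℕ) • (a ^ (n - j) * b ^ (j - 1)) := by
  have h1 : a ^ k * oddBinomialSum a b (n - k) =
      ∑ j ∈ Finset.range (n + 1) with Odd j,
        ((n - k).choose j : R) * a ^ (n - j) * b ^ (j - 1) := by
    rw [oddBinomialSum, Finset.mul_sum]
    refine Finset.sum_subset_zero_on_sdiff ?_ ?_ ?_
    · exact Finset.filter_subset_filter _ (Finset.range_subset_range.2 (by omega))
    · intro j hj
      simp only [Finset.mem_sdiff, Finset.mem_filter, Finset.mem_range] at hj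
      have : n - k < j := by
        by_contra hlt
        exact hj.2 ⟨by omega, hj.1.2⟩
      rw [Nat.choose_eq_zero_of_lt this]
      simp
    · intro j hj
      simp only [Finset.mem_filter, Finset.mem_range] at hj
      rw [show n - j = k + (n - k - j) by omega, pow_add]
      ring
  rw [h1, oddBinomialSum, ← Finset.sum_sub_distrib]
  refine Finset.sum_congr rfl fun j _ => ?_
  rw [nsmul_eq_mul, Nat.cast_sub (Nat.choose_le_choose j (Nat.sub_le n k))]
  ring

theorem SymFamily.isSchurPositive_psi_sub {m k : ℕ} (hk : k ≤ m) :
    IsSchurPositive (psi (twosPartition m) - h 2 ^ k * psi (twosPartition (m - k))) := by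
  rw [psi_twosPartition_eq_oddBinomialSum, psi_twosPartition_eq_oddBinomialSum,
    show m - k + 1 = m + 1 - k by omega, oddBinomialSum_sub _ _ (by omega)]
  exact .sum fun j _ => (isSchurPositive_h_two_pow_mul_e_two_pow _ _).nsmul _

/-- Pascal's rule turns `C(m+1, j) - C(m, j)` into `C(m, j-1)` for `j ≤ m`; the top term `j = m + 1`
is split off as `e_2^m`, present when `m + 1` is odd. -/
theorem SymFamily.psi_sub_h_two_mul_psi {m : ℕ} (hm : 1 ≤ m) :
    psi (twosPartition m) - h 2 * psi (twosPartition (m - 1)) =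
      ∑ j ∈ Finset.Icc 1 m with Odd j,
        (m.choose (j - 1) : SymFamily) * h 2 ^ (m + 1 - j) * e 2 ^ (j - 1)
      + e 2 ^ m * (if Odd (m + 1) then 1 else 0) := by
  have h1 := oddBinomialSum_sub (h 2) (e 2) (n := m + 1) (k := 1) (by omega)
  rw [pow_one] at h1
  rw [psi_twosPartition_eq_oddBinomialSum, psi_twosPartition_eq_oddBinomialSum,
    show m - 1 + 1 = m + 1 - 1 by omega, h1, Finset.sum_filter, Finset.sum_range_succ,
    ← Finset.sum_filter]
  congr 1
  · have hs : (Finset.range (m + 1)).filter Odd = (Finset.Icc 1 m).filter Odd := by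
      ext j
      simp only [Finset.mem_filter, Finset.mem_range, Finset.mem_Icc]
      refine and_congr_left fun hj => ?_
      have := hj.pos
      omega
    rw [hs]
    refine Finset.sum_congr rfl fun j hj => ?_
    obtain ⟨i, rfl⟩ : ∃ i, j = i + 1 :=
      ⟨j - 1, by have := (Finset.mem_Icc.1 (Finset.mem_filter.1 hj).1).1; omega⟩
    rw [Nat.add_sub_cancel, Nat.choose_succ_succ', Nat.add_sub_cancel, Nat.add_sub_cancel,
      nsmul_eq_mul, mul_assoc]
  · simp

theorem lemma3p3 :
    (∀ m : ℕ, 1 ≤ m →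
      SymFamily.IsSchurPositive
        (psi (twosPartition m) - SymFamily.h 2 * psi (twosPartition (m - 1))) ∧
      psi (twosPartition m) - SymFamily.h 2 * psi (twosPartition (m - 1)) =
        ∑ j ∈ Finset.Icc 1 m with Odd j,
          (m.choose (j - 1) : SymFamily) * SymFamily.h 2 ^ (m + 1 - j) * SymFamily.e 2 ^ (j - 1)
        + SymFamily.e 2 ^ m * (if Odd (m + 1) then 1 else 0)) ∧
    (∀ m k : ℕ, k ≤ m →
      SymFamily.IsSchurPositive
        (psi (twosPartition m) - SymFamily.h 2 ^ k * psi (twosPartition (m - k)))) := by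
  refine ⟨fun m hm => ⟨?_, SymFamily.psi_sub_h_two_mul_psi hm⟩,
    fun m k hk => SymFamily.isSchurPositive_psi_sub hk⟩
  simpa only [pow_one] using SymFamily.isSchurPositive_psi_sub hm
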